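/- Let $m\ge 0$ and let $F_1,\dots,F_m$ be arbitrary probability distributions on $[0,\infty)$. A seller has $m$ items and faces a single risk-neutral unit-demand agent, whose values $v_1,\dots,v_m$ for the items are independent with $v_j\sim F_j$. A (truthful) randomized mechanism consists of measurable maps $q:[0,\infty)^m\to[0,1]^m$ with $\sum_j q_j(v)\le 1$ and $\pi:[0,\infty)^m\to\mathbb R$: on report $v$ the agent receives item $j$ with probability $q_j(v)$ (and nothing with the remaining probability) and pays $\pi(v)$. For all $v,w\in[0,\infty)^m$ it is required that $$\sum_j q_j(v)v_j-\pi(v)\ \ge\ \sum_j q_j(w)v_j-\pi(w)\qquad\text{and}\qquad \sum_j q_j(v)v_j-\pi(v)\ \ge\ 0,$$ that is, incentive compatibility and individual rationality. A (truthful) deterministic mechanism is such a mechanism with $q(v)\in\{0,1\}^m$ for all $v$, so that on each report at most one item is allocated, with certainty. The expected revenue of a mechanism is $\mathbb E_{v}[\pi(v)]\in[-\infty,\infty]$; mechanisms for which this expectation does not exist are disregarded (their revenue is counted as $-\infty$). Let $\mathrm{OPT}_{\mathrm{rand}}$ and $\mathrm{OPT}_{\mathrm{det}}$ be the suprema, in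 $[-\infty,\infty]$, of the expected revenues of all randomized and of all deterministic mechanisms, respectively. Then $$\mathrm{OPT}_{\mathrm{det}}\ \ge\ \tfrac14\,\mathrm{OPT}_{\mathrm{rand}}.$$ -/

import Mathlib

open MeasureTheory
open scoped NNReal ENNReal

noncomputable section

namespace UnitDemand

/-- A valuation vector (type) of a single agent: her value for each of the `m` items. -/
abbrev Valuation (m : ℕ) : Type := Fin m → ℝ≥0

/-- Expectation in `[-∞, ∞]` of a real payment rule `π` when the type is distributed as `μ`.
It is the expectation of the positive part minus that of the negative part; when both are
infinite the expectation does not exist, and the value is `⊥` (as `⊤ - ⊤ = ⊥` in `EReal`), so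
that such a rule never contributes to a supremum of revenues. -/
def expectedRevenue {m : ℕ} (μ : Measure (Valuation m)) (π : Valuation m → ℝ) : EReal :=
  ((∫⁻ v, ENNReal.ofReal (π v) ∂μ : ℝ≥0∞) : EReal)
    - ((∫⁻ v, ENNReal.ofReal (-π v) ∂μ : ℝ≥0∞) : EReal)

/-- A lottery over `m` items: item `j` is received with probability `prob j` (no item with the
remaining probability), and the price `price` is paid. -/
structure Lottery (m : ℕ) where
  prob : Fin m → ℝ
  price : ℝ
  prob_nonneg : ∀ j, 0 ≤ prob j
  sum_prob_le_one : ∑ j, prob j ≤ 1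

/-- Expected utility of a risk-neutral unit-demand agent of type `v` from a lottery. -/
def Lottery.utility {m : ℕ} (l : Lottery m) (v : Valuation m) : ℝ :=
  ∑ j, l.prob j * (v j : ℝ) - l.price

/-- A truthful randomized mechanism for a single unit-demand agent: each report is mapped to
a distribution over "item `j`" / "nothing" and a price, such that reporting the true type is
optimal and gives nonnegative expected utility. -/
structure RandomizedMechanism (m : ℕ) where
  outcome : Valuation m → Lottery m
  measurable_prob : ∀ j, Measurable fun v => (outcome v).prob j
  measurable_price : Measurable fun v => (outcome v).price
  incentive_compatible : ∀ v w, (outcome w).utility v ≤ (outcome v).utility v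
  individually_rational : ∀ v, 0 ≤ (outcome v).utility v

/-- Value of an agent of type `v` for receiving one item (`some j`) or nothing (`none`). -/
def allocValue {m : ℕ} (v : Valuation m) (a : Option (Fin m)) : ℝ :=
  a.elim 0 fun j => (v j : ℝ)

/-- A truthful deterministic mechanism for a single unit-demand agent: each report is mapped to
at most one item and a price, such that reporting the true type is optimal and gives
nonnegative utility. -/
structure DeterministicMechanism (m : ℕ) where
  alloc : Valuation m → Option (Fin m)
  price : Valuation m → ℝ
  measurableSet_alloc : ∀ j, MeasurableSet {v | alloc v = some j}
  measurable_price : Measurable price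
  incentive_compatible : ∀ v w,
    allocValue v (alloc w) - price w ≤ allocValue v (alloc v) - price v
  individually_rational : ∀ v, 0 ≤ allocValue v (alloc v) - price v

/-- Optimal (supremal) expected revenue of truthful randomized mechanisms. -/
def optRandomizedRevenue {m : ℕ} (μ : Measure (Valuation m)) : EReal :=
  ⨆ M : RandomizedMechanism m, expectedRevenue μ fun v => (M.outcome v).price

/-- Optimal (supremal) expected revenue of truthful deterministic mechanisms. -/
def optDeterministicRevenue {m : ℕ} (μ : Measure (Valuation m)) : EReal :=
  ⨆ M : DeterministicMechanism m, expectedRevenue μ M.price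

end UnitDemand

end

/-!
Fix a real `τ` that exceeds the revenue of every item pricing; it suffices that then no
randomized mechanism earns more than `4 * τ`.

*Item pricings.* With prices `p j ≥ τ`, let `P₀` be the probability that no item is affordable.
Every sale earns `τ`, and with probability at least `P₀ * F j [p j, ∞)` item `j` is the only
affordable one and earns `p j - τ` on top. So the revenue is at least
`τ * (1 - P₀) + P₀ * ∑ j, (p j - τ) * F j [p j, ∞)` (`le_lintegral_itemPricingPrice`). As this is
less than `τ`, the sum is at most `τ` for all prices (`sum_excess_le`), that is, `∑ j, B j ≤ τ` for
`B j = ⨆ p, (p - τ)⁺ * F j [p, ∞)`. This replaces a threshold on ironed virtual values, and needs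
neither densities nor tie-breaking at atoms.

*One-parameter mechanisms.* A truthful mechanism for one bidder and one item is a mixture of posted
prices, so its expected revenue minus `τ` per unit of allocation is at most `B j`
(`lintegral_payment_le_of_postedPrice_le`).

*Randomized mechanisms.* Let `u` be the utility of the truthful type, `q` the allocation, `j` an item
of largest value and `s` the largest value of the other items. Individual rationality at the type
`v[j := s]` and `∑ k ≠ j, q k * v k ≤ s` give
`price v ≤ (v j * q j v - (u v - u v[j := s])) + s` (`price_le_copyPayment_add`).
For fixed values of the other items, the first summand is the payment in a truthful one-parameter
mechanism for `j`, and `s` is a price posted for `j`. Taking `τ` per unit of allocation out of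
each of the two leaves an excess charged to the items, of expectation at most `2 * ∑ j, B j`; since
each of the two allocates at most one unit, the total is at most
`2 * τ + 2 * ∑ j, B j ≤ 4 * τ` (`lintegral_price_le`).
-/

namespace UnitDemand

/-! ### One-parameter mechanisms against a posted-price bound -/

/-- A function on an interval is nonincreasing along it if its increments are at most of second
order, with respect to some function `x`. -/
lemma le_of_forall_increment_le {D x : ℝ≥0 → ℝ} {s : ℝ≥0}
    (h : ∀ a b, s ≤ a → a ≤ b → D b - D a ≤ ((b : ℝ) - a) * (x b - x a)) (d : ℝ≥0) :
    D (s + d) ≤ D s := by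
  -- Subdividing `[s, s + d]` into `n` equal steps bounds the total increment by a multiple of `1/n`.
  have key : ∀ n : ℕ, 0 < n → n * (D (s + d) - D s) ≤ d * (x (s + d) - x s) := by
    intro n hn
    have hn' : (0 : ℝ) < n := by exact_mod_cast hn
    have hind : ∀ i : ℕ, D (s + i * (d / n)) - D s ≤
        ((d : ℝ) / n) * (x (s + i * (d / n)) - x s) := by
      intro i
      induction i with
      | zero => simp
      | succ i ih =>
        have hle : s + (i : ℝ≥0) * (d / n) ≤ s + ((i + 1 : ℕ) : ℝ≥0) * (d / n) := by
          gcongr; simp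
        have := h _ _ le_self_add hle
        have e : ((s + ((i + 1 : ℕ) : ℝ≥0) * (d / n) : ℝ≥0) : ℝ)
            - ((s + (i : ℝ≥0) * (d / n) : ℝ≥0) : ℝ) = (d : ℝ) / n := by
          push_cast; ring
        rw [e] at this
        linarith
    have h1 := hind n
    have h2 : (n : ℝ≥0) * (d / n) = d := mul_div_cancel₀ _ (by positivity)
    rw [h2, div_mul_eq_mul_div, le_div_iff₀ hn'] at h1
    linarith
  by_contra! hlt
  have he : 0 < D (s + d) - D s := by linarith
  obtain ⟨n, hn⟩ := exists_nat_gt (d * (x (s + d) - x s) / (D (s + d) - D s))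
  rw [div_lt_iff₀ he] at hn
  have h1 := key 1 one_pos
  have hn0 : 0 < n := by
    rcases Nat.eq_zero_or_pos n with rfl | h0
    · simp only [Nat.cast_one, Nat.cast_zero, zero_mul, one_mul] at h1 hn
      linarith
    · exact h0
  linarith [key n hn0]

/-- The lowest type above `s` that is served with probability at least `y` under the allocation
rule `x` (`⊤` if there is none): a monotone rule is the mixture over `y ∈ (0, 1]` of posting this
price. -/
noncomputable def levelPrice (x : ℝ≥0 → ℝ) (s : ℝ≥0) (y : ℝ) : ℝ≥0∞ :=
  ⨅ t : ℝ≥0, ⨅ _ : s ≤ t ∧ y ≤ x t, (t : ℝ≥0∞)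

lemma levelPrice_mono (x : ℝ≥0 → ℝ) (s : ℝ≥0) : Monotone (levelPrice x s) := by
  intro y z hyz
  exact le_iInf₂ fun t ht => iInf₂_le t ⟨ht.1, hyz.trans ht.2⟩

lemma levelPrice_le {x : ℝ≥0 → ℝ} {s t : ℝ≥0} {y : ℝ} (hst : s ≤ t) (hy : y ≤ x t) :
    levelPrice x s y ≤ t :=
  iInf₂_le t ⟨hst, hy⟩

/-- In a truthful one-parameter mechanism on `[s, ∞)` with allocation `x` and payment `pay`, the
payment is at most that of the mixture of posted prices `levelPrice x s y`. The two revenues grow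
alike up to second-order terms: between types `a ≤ b` both increase by
`x b - x a` times a price in `[a, b]`. -/
lemma ofReal_payment_le_lintegral_levelPrice {x pay : ℝ≥0 → ℝ} {s : ℝ≥0} (τ : ℝ≥0)
    (hx0 : ∀ t, 0 ≤ x t)
    (hic : ∀ t w : ℝ≥0, t * x w - pay w ≤ t * x t - pay t)
    (hir : pay s ≤ s * x s) {t : ℝ≥0} (hst : s ≤ t) :
    ENNReal.ofReal (pay t - τ * x t) ≤
      ∫⁻ y in Set.Ioc 0 (x t), (levelPrice x s y - τ) := by
  have hmono : Monotone x := by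
    intro a b hab
    rcases hab.eq_or_lt with rfl | hab
    · rfl
    have h1 := hic a b
    have h2 := hic b a
    have h3 : (a : ℝ) < b := by exact_mod_cast hab
    by_contra! h4
    nlinarith [mul_pos (sub_pos.2 h3) (sub_pos.2 h4)]
  set Ψ : ℝ≥0 → ℝ≥0∞ := fun t => ∫⁻ y in Set.Ioc 0 (x t), (levelPrice x s y - τ) with hΨ
  have hfin : ∀ t, s ≤ t → Ψ t ≠ ⊤ := by
    intro t ht
    have : Ψ t ≤ ∫⁻ y in Set.Ioc 0 (x t), (t : ℝ≥0∞) :=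
      setLIntegral_mono measurable_const fun y hy =>
        tsub_le_self.trans (levelPrice_le ht hy.2)
    refine ne_top_of_le_ne_top ?_ this
    rw [setLIntegral_const, Real.volume_Ioc]
    exact ENNReal.mul_ne_top ENNReal.coe_ne_top ENNReal.ofReal_ne_top
  have hstep : ∀ a b, s ≤ a → a ≤ b →
      (Ψ a).toReal + ((a : ℝ) - τ) * (x b - x a) ≤ (Ψ b).toReal := by
    intro a b ha hab
    have hsplit : Ψ b = Ψ a + ∫⁻ y in Set.Ioc (x a) (x b), (levelPrice x s y - τ) := by
      simp only [hΨ]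
      rw [← Set.Ioc_union_Ioc_eq_Ioc (hx0 a) (hmono hab),
        lintegral_union measurableSet_Ioc (Set.Ioc_disjoint_Ioc_of_le le_rfl)]
    have hlow : ((a : ℝ≥0∞) - τ) * ENNReal.ofReal (x b - x a) ≤
        ∫⁻ y in Set.Ioc (x a) (x b), (levelPrice x s y - τ) := by
      rw [← Real.volume_Ioc, ← setLIntegral_const]
      refine setLIntegral_mono' measurableSet_Ioc fun y hy => tsub_le_tsub_right ?_ _
      refine le_iInf₂ fun w hw => ?_
      -- a type below `a` is served with probability at most `x a < y`
      have : ¬ w < a := fun h => absurd (hmono h.le) (not_le.2 (hy.1.trans_le hw.2))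
      exact_mod_cast not_lt.1 this
    have h1 : Ψ a + ((a : ℝ≥0∞) - τ) * ENNReal.ofReal (x b - x a) ≤ Ψ b := by
      rw [hsplit]; gcongr
    have h2 := ENNReal.toReal_mono (hfin b (ha.trans hab)) h1
    rw [ENNReal.toReal_add (hfin a ha) (ENNReal.mul_ne_top (by finiteness) (by finiteness)),
      ENNReal.toReal_mul, ENNReal.toReal_ofReal (sub_nonneg.2 (hmono hab))] at h2
    refine le_trans ?_ h2
    gcongr
    · exact sub_nonneg.2 (hmono hab)
    · rw [← ENNReal.coe_sub, ENNReal.coe_toReal]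
      exact NNReal.sub_def ▸ Real.le_coe_toNNReal _
  have hbase : (s - τ) * x s ≤ (Ψ s).toReal := by
    have hlow : ((s : ℝ≥0∞) - τ) * ENNReal.ofReal (x s - 0) ≤ Ψ s := by
      rw [← Real.volume_Ioc, ← setLIntegral_const]
      refine setLIntegral_mono' measurableSet_Ioc fun y hy => tsub_le_tsub_right ?_ _
      exact le_iInf₂ fun w hw => by exact_mod_cast hw.1
    have h2 := ENNReal.toReal_mono (hfin s le_rfl) hlow
    rw [ENNReal.toReal_mul, sub_zero, ENNReal.toReal_ofReal (hx0 s)] at h2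
    refine le_trans ?_ h2
    gcongr
    · exact hx0 s
    · rw [← ENNReal.coe_sub, ENNReal.coe_toReal]
      exact NNReal.sub_def ▸ Real.le_coe_toNNReal _
  obtain ⟨d, rfl⟩ := exists_add_of_le hst
  have hD := le_of_forall_increment_le (D := fun t => pay t - τ * x t - (Ψ t).toReal) (x := x)
    (s := s) (fun a b ha hab => by
      have h1 := hstep a b ha hab
      have h2 := hic b a
      linarith) d
  refine ENNReal.ofReal_le_of_le_toReal ?_
  change _ ≤ (Ψ (s + d)).toReal
  linarith

/-- If no posted price `p` earns more than `B` from a buyer with value distribution `F`, when each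
sale costs `τ`, then neither does any truthful one-parameter mechanism, restricted to the types
above `s`. -/
lemma lintegral_payment_le_of_postedPrice_le {F : Measure ℝ≥0} [SFinite F] {τ : ℝ≥0} {B : ℝ≥0∞}
    (hB : ∀ p : ℝ≥0, ((p : ℝ≥0∞) - τ) * F (Set.Ici p) ≤ B)
    {x pay : ℝ≥0 → ℝ} {s : ℝ≥0} (hx : Measurable x)
    (hx0 : ∀ t, 0 ≤ x t) (hx1 : ∀ t, x t ≤ 1)
    (hic : ∀ t w : ℝ≥0, t * x w - pay w ≤ t * x t - pay t)
    (hir : pay s ≤ s * x s) :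
    ∫⁻ t in Set.Ici s, ENNReal.ofReal (pay t - τ * x t) ∂F ≤ B := by
  have hP : Measurable fun y => levelPrice x s y - τ :=
    (levelPrice_mono x s).measurable.sub_const _
  calc ∫⁻ t in Set.Ici s, ENNReal.ofReal (pay t - τ * x t) ∂F
      ≤ ∫⁻ t in Set.Ici s, (∫⁻ y in Set.Ioc 0 (x t), (levelPrice x s y - τ)) ∂F :=
        setLIntegral_mono' measurableSet_Ici fun t ht =>
          ofReal_payment_le_lintegral_levelPrice τ hx0 hic hir ht
    _ = ∫⁻ t in Set.Ici s, (∫⁻ y in Set.Ioc (0 : ℝ) 1,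
          {z : ℝ≥0 × ℝ | z.2 ≤ x z.1}.indicator (fun z => levelPrice x s z.2 - τ) (t, y)) ∂F := by
        congr 1 with t
        rw [← lintegral_indicator measurableSet_Ioc, ← lintegral_indicator measurableSet_Ioc]
        congr 1 with y
        by_cases h : y ≤ x t
        · simp [Set.indicator, h, h.trans (hx1 t)]
        · simp [Set.indicator, h]
    _ = ∫⁻ y in Set.Ioc (0 : ℝ) 1, ∫⁻ t in Set.Ici s,
          {z : ℝ≥0 × ℝ | z.2 ≤ x z.1}.indicator (fun z => levelPrice x s z.2 - τ) (t, y) ∂F := by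
        refine lintegral_lintegral_swap (Measurable.aemeasurable ?_)
        exact (hP.comp measurable_snd).indicator
          (measurableSet_le measurable_snd (hx.comp measurable_fst))
    _ ≤ ∫⁻ y in Set.Ioc (0 : ℝ) 1, B := by
        refine lintegral_mono fun y => ?_
        have hle : ∫⁻ t in Set.Ici s,
            {z : ℝ≥0 × ℝ | z.2 ≤ x z.1}.indicator (fun z => levelPrice x s z.2 - τ) (t, y) ∂F
            ≤ ∫⁻ t, {t : ℝ≥0 | levelPrice x s y ≤ t}.indicator
              (fun _ => levelPrice x s y - τ) t ∂F := by
          rw [← lintegral_indicator measurableSet_Ici]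
          refine lintegral_mono fun t => ?_
          by_cases ht : s ≤ t
          · by_cases hy : y ≤ x t
            · simp [Set.indicator, ht, hy, levelPrice_le ht hy]
            · simp [Set.indicator, hy]
          · simp [Set.indicator, ht]
        refine hle.trans ?_
        have hms : MeasurableSet {t : ℝ≥0 | levelPrice x s y ≤ t} :=
          measurableSet_le measurable_const measurable_coe_nnreal_ennreal
        rw [lintegral_indicator_const hms]
        induction h : levelPrice x s y using ENNReal.recTopCoe with
        | top => simp
        | coe p =>
          have : {t : ℝ≥0 | (p : ℝ≥0∞) ≤ t} = Set.Ici p := by ext; simp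
          rw [this]
          exact hB p
    _ = B := by simp

variable {m : ℕ}

/-! ### Item pricings -/

/-- Item `j` is affordable at prices `p` and maximizes the utility of type `v`. -/
def IsFavorite (p v : Valuation m) (j : Fin m) : Prop :=
  p j ≤ v j ∧ ∀ k, (v k : ℝ) - p k ≤ (v j : ℝ) - p j

lemma measurableSet_isFavorite (p : Valuation m) (j : Fin m) :
    MeasurableSet {v | IsFavorite p v j} := by
  simp only [IsFavorite, Set.ofPred_and, Set.ofPred_forall]
  refine (measurableSet_le measurable_const (measurable_pi_apply j)).inter ?_
  refine MeasurableSet.iInter fun k => measurableSet_le ?_ ?_ <;> fun_prop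

lemma exists_isFavorite {p v : Valuation m} {j : Fin m} (hj : p j ≤ v j) :
    ∃ i, IsFavorite p v i := by
  have : Nonempty (Fin m) := ⟨j⟩
  obtain ⟨i, hi⟩ := Finite.exists_max fun k => (v k : ℝ) - p k
  refine ⟨i, ?_, hi⟩
  have h1 := hi j
  have h2 : (p j : ℝ) ≤ v j := by exact_mod_cast hj
  have : (p i : ℝ) ≤ v i := by linarith
  exact_mod_cast this

open Classical in
/-- The item bought by type `v` at prices `p`: the first of the favorite items, if any. A buyer who
is indifferent between buying and not buying buys. -/
noncomputable def itemPricingAlloc (p v : Valuation m) : Option (Fin m) :=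
  Fin.find? fun j => decide (IsFavorite p v j)

lemma itemPricingAlloc_eq_some {p v : Valuation m} {j : Fin m} :
    itemPricingAlloc p v = some j ↔ IsFavorite p v j ∧ ∀ i < j, ¬ IsFavorite p v i := by
  simp [itemPricingAlloc]

lemma itemPricingAlloc_eq_none {p v : Valuation m} :
    itemPricingAlloc p v = none ↔ ∀ j, v j < p j := by
  have : itemPricingAlloc p v = none ↔ ∀ j, ¬ IsFavorite p v j := by
    simp [itemPricingAlloc]
  rw [this]
  constructor
  · intro h j
    by_contra! hj
    obtain ⟨i, hi⟩ := exists_isFavorite hj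
    exact h i hi
  · exact fun h j hj => absurd hj.1 (not_le.2 (h j))

lemma measurableSet_itemPricingAlloc (p : Valuation m) (j : Fin m) :
    MeasurableSet {v | itemPricingAlloc p v = some j} := by
  simp only [itemPricingAlloc_eq_some, Set.ofPred_and, Set.ofPred_forall]
  exact (measurableSet_isFavorite p j).inter <| MeasurableSet.iInter fun i =>
    MeasurableSet.iInter fun _ => (measurableSet_isFavorite p i).compl

/-- The payment of type `v` at item prices `p`. -/
noncomputable def itemPricingPrice (p v : Valuation m) : ℝ≥0 :=
  (itemPricingAlloc p v).elim 0 p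

lemma itemPricingPrice_eq_sum (p v : Valuation m) :
    itemPricingPrice p v = ∑ j, {v | itemPricingAlloc p v = some j}.indicator (fun _ => p j) v := by
  unfold itemPricingPrice
  cases h : itemPricingAlloc p v with
  | none => simp [Set.indicator, h]
  | some j => simp [Set.indicator, h]

lemma measurable_itemPricingPrice (p : Valuation m) : Measurable (itemPricingPrice p) := by
  have : itemPricingPrice p = fun v =>
      ∑ j, {v | itemPricingAlloc p v = some j}.indicator (fun _ => p j) v :=
    funext (itemPricingPrice_eq_sum p)
  rw [this]
  exact Finset.measurable_sum _ fun j _ =>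
    measurable_const.indicator (measurableSet_itemPricingAlloc p j)

/-- The mechanism that offers every item `j` at price `p j`. -/
noncomputable def itemPricing (p : Valuation m) : DeterministicMechanism m where
  alloc := itemPricingAlloc p
  price v := itemPricingPrice p v
  measurableSet_alloc := measurableSet_itemPricingAlloc p
  measurable_price := (measurable_itemPricingPrice p).coe_nnreal_real
  incentive_compatible v w := by
    unfold itemPricingPrice
    cases hw : itemPricingAlloc p w with
    | none =>
      cases hv : itemPricingAlloc p v with
      | none => simp
      | some i =>
        have := (itemPricingAlloc_eq_some.1 hv).1.1
        simpa [allocValue] using this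
    | some k =>
      cases hv : itemPricingAlloc p v with
      | none =>
        have := (itemPricingAlloc_eq_none.1 hv k).le
        simpa [allocValue] using this
      | some i => simpa [allocValue] using (itemPricingAlloc_eq_some.1 hv).1.2 k
  individually_rational v := by
    unfold itemPricingPrice
    cases hv : itemPricingAlloc p v with
    | none => simp [allocValue]
    | some i =>
      have := (itemPricingAlloc_eq_some.1 hv).1.1
      simpa [allocValue] using this

lemma expectedRevenue_itemPricing (μ : Measure (Valuation m)) (p : Valuation m) :
    expectedRevenue μ (itemPricing p).price =
      ((∫⁻ v, (itemPricingPrice p v : ℝ≥0∞) ∂μ : ℝ≥0∞) : EReal) := by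
  have : ∀ v, ENNReal.ofReal (-(itemPricingPrice p v : ℝ)) = 0 := fun v =>
    ENNReal.ofReal_of_nonpos (neg_nonpos.2 (itemPricingPrice p v).2)
  simp [expectedRevenue, itemPricing, this]

/-- With prices at least `τ`, every sale earns `τ`, and if `j` is the only affordable item, its sale
earns `p j - τ` on top. -/
lemma le_itemPricingPrice {τ : ℝ≥0} {p : Valuation m} (hp : ∀ j, τ ≤ p j) (v : Valuation m) :
    {v : Valuation m | ∀ j, v j < p j}ᶜ.indicator (fun _ => (τ : ℝ≥0∞)) v
      + ∑ j, {v : Valuation m | p j ≤ v j ∧ ∀ k ≠ j, v k < p k}.indicator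
          (fun _ => (p j : ℝ≥0∞) - τ) v ≤ itemPricingPrice p v := by
  unfold itemPricingPrice
  cases h : itemPricingAlloc p v with
  | none =>
    have h' := itemPricingAlloc_eq_none.1 h
    have : ∀ j, ¬ p j ≤ v j := fun j => not_le.2 (h' j)
    simp [Set.indicator, h', this]
  | some i =>
    have hi := (itemPricingAlloc_eq_some.1 h).1.1
    have hzero : ∀ j ∈ Finset.univ, j ≠ i →
        {v : Valuation m | p j ≤ v j ∧ ∀ k ≠ j, v k < p k}.indicator
        (fun _ => (p j : ℝ≥0∞) - τ) v = 0 := by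
      intro j _ hji
      refine Set.indicator_of_notMem (fun hmem => ?_) _
      exact absurd hi (not_le.2 (hmem.2 i hji.symm))
    rw [Finset.sum_eq_single_of_mem i (Finset.mem_univ i) hzero]
    calc _ ≤ (τ : ℝ≥0∞) + (p i - τ) :=
          add_le_add (Set.indicator_le_self' (fun _ _ => zero_le) v)
            (Set.indicator_le_self' (fun _ _ => zero_le) v)
      _ = p i := add_tsub_cancel_of_le (by exact_mod_cast hp i)

/-- Prophet-inequality bound on the revenue of item prices `p j ≥ τ`: here
`P₀ = μ {v | ∀ j, v j < p j}` is the probability of no sale. By independence, item `j` is the only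
affordable one with probability at least `P₀ * F j [p j, ∞)`. -/
lemma le_lintegral_itemPricingPrice (F : Fin m → Measure ℝ≥0) [∀ j, IsProbabilityMeasure (F j)]
    {τ : ℝ≥0} {p : Valuation m} (hp : ∀ j, τ ≤ p j) :
    τ * Measure.pi F {v | ∀ j, v j < p j}ᶜ
      + Measure.pi F {v | ∀ j, v j < p j} * ∑ j, ((p j : ℝ≥0∞) - τ) * F j (Set.Ici (p j))
      ≤ ∫⁻ v, (itemPricingPrice p v : ℝ≥0∞) ∂Measure.pi F := by
  have hN : {v : Valuation m | ∀ j, v j < p j} = Set.univ.pi fun j => Set.Iio (p j) := by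
    ext; simp
  have hE : ∀ j, {v : Valuation m | p j ≤ v j ∧ ∀ k ≠ j, v k < p k} =
      Set.univ.pi (Function.update (fun k => Set.Iio (p k)) j (Set.Ici (p j))) := by
    intro j
    ext v
    simp only [Set.mem_ofPred_eq, Set.mem_univ_pi]
    constructor
    · rintro ⟨h1, h2⟩ k
      rcases eq_or_ne k j with rfl | hk
      · simpa using h1
      · simpa [hk] using h2 k hk
    · intro h
      refine ⟨by simpa using h j, fun k hk => by simpa [hk] using h k⟩
  have hmN : MeasurableSet {v : Valuation m | ∀ j, v j < p j} := by
    rw [hN]; exact MeasurableSet.univ_pi fun j => measurableSet_Iio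
  have hmE : ∀ j, MeasurableSet {v : Valuation m | p j ≤ v j ∧ ∀ k ≠ j, v k < p k} := by
    intro j
    rw [hE]
    refine MeasurableSet.univ_pi fun k => ?_
    rcases eq_or_ne k j with rfl | hk
    · simp
    · simp [hk]
  have hprob : ∀ j, Measure.pi F {v | ∀ j, v j < p j} * F j (Set.Ici (p j)) ≤
      Measure.pi F {v | p j ≤ v j ∧ ∀ k ≠ j, v k < p k} := by
    intro j
    rw [hN, hE, Measure.pi_pi, Measure.pi_pi, ← Finset.mul_prod_erase _ _ (Finset.mem_univ j),
      ← Finset.mul_prod_erase Finset.univ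
        (fun i => F i (Function.update (fun k => Set.Iio (p k)) j (Set.Ici (p j)) i))
        (Finset.mem_univ j)]
    have hupd : ∏ k ∈ Finset.univ.erase j,
        F k (Function.update (fun k => Set.Iio (p k)) j (Set.Ici (p j)) k) =
        ∏ k ∈ Finset.univ.erase j, F k (Set.Iio (p k)) :=
      Finset.prod_congr rfl fun k hk => by
        rw [Function.update_of_ne (Finset.ne_of_mem_erase hk)]
    rw [Function.update_self, hupd, mul_comm]
    gcongr
    exact mul_le_of_le_one_left' prob_le_one
  refine le_trans ?_ (lintegral_mono (le_itemPricingPrice hp))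
  rw [lintegral_add_left (measurable_const.indicator hmN.compl),
    lintegral_finsetSum _ fun j _ => measurable_const.indicator (hmE j),
    lintegral_indicator_const hmN.compl, Finset.mul_sum]
  gcongr with j
  rw [lintegral_indicator_const (hmE j), mul_left_comm]
  gcongr
  exact hprob j

/-- If no item pricing earns `τ` or more, then for all prices the expected excess revenues over `τ`
of selling each item separately add up to at most `τ`. -/
lemma sum_excess_le (F : Fin m → Measure ℝ≥0) [∀ j, IsProbabilityMeasure (F j)] {τ : ℝ≥0}
    (hτ : ∀ p : Valuation m, ∫⁻ v, (itemPricingPrice p v : ℝ≥0∞) ∂Measure.pi F < τ)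
    (p : Valuation m) :
    ∑ j, ((p j : ℝ≥0∞) - τ) * F j (Set.Ici (p j)) ≤ τ := by
  -- Raising a price below `τ` to `τ` leaves the vanishing excess at zero.
  set p' : Valuation m := fun j => max (p j) τ
  have hp' : ∑ j, ((p j : ℝ≥0∞) - τ) * F j (Set.Ici (p j)) =
      ∑ j, ((p' j : ℝ≥0∞) - τ) * F j (Set.Ici (p' j)) := by
    refine Finset.sum_congr rfl fun j _ => ?_
    rcases le_total (p j) τ with h | h
    · have : (p j : ℝ≥0∞) ≤ τ := by exact_mod_cast h
      simp [p', h, tsub_eq_zero_of_le this]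
    · simp [p', h]
  rw [hp']
  by_contra! hlt
  have h1 := le_lintegral_itemPricingPrice F (p := p') (fun j => le_max_right (p j) τ)
  have hmN : MeasurableSet {v : Valuation m | ∀ j, v j < p' j} := by
    have : {v : Valuation m | ∀ j, v j < p' j} = Set.univ.pi fun j => Set.Iio (p' j) := by
      ext; simp
    rw [this]; exact MeasurableSet.univ_pi fun j => measurableSet_Iio
  refine absurd (hτ p') (not_lt.2 (le_trans ?_ h1))
  calc (τ : ℝ≥0∞) = τ * Measure.pi F {v | ∀ j, v j < p' j}ᶜ
        + Measure.pi F {v | ∀ j, v j < p' j} * τ := by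
        rw [mul_comm _ (τ : ℝ≥0∞), ← mul_add, add_comm, measure_add_measure_compl hmN,
          measure_univ, mul_one]
    _ ≤ _ := by gcongr

/-- A bound on a finite sum, uniform over independent choices of the arguments, bounds the sum of
the suprema. -/
lemma sum_iSup_le_of_forall_sum_le {ι α : Type*} [DecidableEq ι] [Nonempty α]
    {f : ι → α → ℝ≥0∞} (S : Finset ι) {C : ℝ≥0∞} (a : ℝ≥0∞)
    (h : ∀ p : ι → α, a + ∑ j ∈ S, f j (p j) ≤ C) : a + ∑ j ∈ S, ⨆ p, f j p ≤ C := by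
  induction S using Finset.induction_on generalizing a with
  | empty => simpa using h (fun _ => Classical.arbitrary α)
  | insert i S hi ih =>
    rw [Finset.sum_insert hi, add_left_comm, ENNReal.iSup_add]
    refine iSup_le fun q => ?_
    rw [← add_assoc]
    refine ih _ fun p => ?_
    have := h (Function.update p i q)
    rw [Finset.sum_insert hi, Function.update_self, Finset.sum_congr rfl
      (g := fun j => f j (p j)) fun j hj => by
        rw [Function.update_of_ne (ne_of_mem_of_not_mem hj hi)]] at this
    rwa [add_comm (f i q) a, add_assoc]

/-! ### Decomposition of the revenue of a randomized mechanism -/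

namespace RandomizedMechanism

/-- The utility of type `v` when reporting truthfully. -/
def truthfulUtility (M : RandomizedMechanism m) (v : Valuation m) : ℝ :=
  (M.outcome v).utility v

lemma measurable_truthfulUtility (M : RandomizedMechanism m) : Measurable M.truthfulUtility := by
  refine Measurable.sub (Finset.measurable_sum _ fun j _ => ?_) M.measurable_price
  exact (M.measurable_prob j).mul (measurable_pi_apply j).coe_nnreal_real

lemma prob_le_one (M : RandomizedMechanism m) (v : Valuation m) (j : Fin m) :
    (M.outcome v).prob j ≤ 1 :=
  (Finset.single_le_sum (fun k _ => (M.outcome v).prob_nonneg k) (Finset.mem_univ j)).trans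
    (M.outcome v).sum_prob_le_one

/-- As a function of the value for item `j` alone, the allocation probability of `j` is a
subgradient of the truthful utility. -/
lemma prob_mul_sub_le (M : RandomizedMechanism m) (v : Valuation m) (j : Fin m) (t w : ℝ≥0) :
    (M.outcome (Function.update v j w)).prob j * ((t : ℝ) - w) ≤
      M.truthfulUtility (Function.update v j t) - M.truthfulUtility (Function.update v j w) := by
  have hic := M.incentive_compatible (Function.update v j t) (Function.update v j w)
  set l := M.outcome (Function.update v j w) with hl
  have hdiff : l.utility (Function.update v j t) - l.utility (Function.update v j w) =
      l.prob j * ((t : ℝ) - w) := by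
    simp only [Lottery.utility, sub_sub_sub_cancel_right, ← Finset.sum_sub_distrib, ← mul_sub]
    rw [Finset.sum_eq_single_of_mem j (Finset.mem_univ j)]
    · simp
    · intro k _ hk
      simp [hk]
  simp only [truthfulUtility, ← hl]
  linarith

end RandomizedMechanism

/-- The largest value for an item other than `j`. -/
def otherMax (j : Fin m) (v : Valuation m) : ℝ≥0 := (Finset.univ.erase j).sup v

lemma measurable_otherMax (j : Fin m) : Measurable (otherMax j) := by
  have h : ∀ S : Finset (Fin m), Measurable fun v : Valuation m => S.sup v := by
    intro S
    induction S using Finset.induction_on with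
    | empty => simp
    | insert k S _ ih =>
      simp only [Finset.sup_insert]
      exact (measurable_pi_apply k).sup ih
  exact h _

lemma otherMax_update (j : Fin m) (v : Valuation m) (t : ℝ≥0) :
    otherMax j (Function.update v j t) = otherMax j v :=
  Finset.sup_congr rfl fun k hk => by rw [Function.update_of_ne (Finset.ne_of_mem_erase hk)]

/-- The truthful payment for copy `j`, when each item is sold to a bidder of its own and copy `j` is
served as in `M`, but only above the other values. The threshold type `v j = otherMax j v`
has utility zero. -/
def copyPayment (M : RandomizedMechanism m) (j : Fin m) (v : Valuation m) : ℝ :=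
  v j * (M.outcome v).prob j
    - (M.truthfulUtility v - M.truthfulUtility (Function.update v j (otherMax j v)))

lemma measurable_copyPayment (M : RandomizedMechanism m) (j : Fin m) :
    Measurable (copyPayment M j) := by
  have h : Measurable fun v : Valuation m => Function.update v j (otherMax j v) :=
    measurable_pi_iff.2 fun k => by
      rcases eq_or_ne k j with rfl | hk
      · simpa using measurable_otherMax k
      · simpa [hk] using measurable_pi_apply k
  exact ((measurable_pi_apply j).coe_nnreal_real.mul (M.measurable_prob j)).sub
    (M.measurable_truthfulUtility.sub (M.measurable_truthfulUtility.comp h))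

/-- The value derived from the items other than `j` is at most `otherMax j v`; the rest of the price
is at most the payment for copy `j`. -/
lemma price_le_copyPayment_add (M : RandomizedMechanism m) (j : Fin m) (v : Valuation m) :
    (M.outcome v).price ≤ copyPayment M j v + otherMax j v := by
  have hir := M.individually_rational (Function.update v j (otherMax j v))
  have hsum : ∑ k, (M.outcome v).prob k * (v k : ℝ) ≤
      (M.outcome v).prob j * v j + otherMax j v := by
    rw [← Finset.add_sum_erase _ _ (Finset.mem_univ j)]
    gcongr
    calc ∑ k ∈ Finset.univ.erase j, (M.outcome v).prob k * (v k : ℝ)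
        ≤ ∑ k ∈ Finset.univ.erase j, (M.outcome v).prob k * (otherMax j v : ℝ) := by
          refine Finset.sum_le_sum fun k hk => ?_
          have : v k ≤ otherMax j v := Finset.le_sup (f := v) hk
          exact mul_le_mul_of_nonneg_left (by exact_mod_cast this)
            ((M.outcome v).prob_nonneg k)
      _ = (∑ k ∈ Finset.univ.erase j, (M.outcome v).prob k) * otherMax j v := by
          rw [Finset.sum_mul]
      _ ≤ 1 * otherMax j v := by
          gcongr
          exact (Finset.sum_le_sum_of_subset_of_nonneg (Finset.erase_subset _ _)
            fun k _ _ => (M.outcome v).prob_nonneg k).trans (M.outcome v).sum_prob_le_one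
      _ = otherMax j v := one_mul _
  have hu : M.truthfulUtility v =
      ∑ k, (M.outcome v).prob k * (v k : ℝ) - (M.outcome v).price := rfl
  have hir' : 0 ≤ M.truthfulUtility (Function.update v j (otherMax j v)) := hir
  unfold copyPayment
  linarith

/-- Pointwise Lagrangian bound: serving the most valued copy and serving the copies by a
second-price auction cost `τ` each; the remaining revenue is charged to the items. -/
lemma ofReal_price_le (M : RandomizedMechanism m) (τ : ℝ≥0) (v : Valuation m) :
    ENNReal.ofReal (M.outcome v).price ≤ 2 * τ + ∑ j,
      ({v | otherMax j v ≤ v j}.indicator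
        (fun v => ENNReal.ofReal (copyPayment M j v - τ * (M.outcome v).prob j)) v
      + {v | otherMax j v ≤ v j}.indicator (fun v => (otherMax j v : ℝ≥0∞) - τ) v) := by
  rcases isEmpty_or_nonempty (Fin m) with hm | hm
  · have hir := M.individually_rational v
    simp only [Lottery.utility, Finset.univ_eq_empty, Finset.sum_empty, zero_sub,
      Left.nonneg_neg_iff] at hir
    simp [ENNReal.ofReal_of_nonpos hir]
  · obtain ⟨j, hj⟩ := Finite.exists_max v
    have hmem : otherMax j v ≤ v j := Finset.sup_le fun k _ => hj k
    refine le_trans ?_ (add_le_add_right (Finset.single_le_sum (fun _ _ => zero_le)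
      (Finset.mem_univ j)) _)
    rw [Set.indicator_of_mem (by exact hmem), Set.indicator_of_mem (by exact hmem)]
    have hτq : (τ : ℝ) * (M.outcome v).prob j ≤ τ :=
      mul_le_of_le_one_right τ.2 (M.prob_le_one v j)
    have hprice := price_le_copyPayment_add M j v
    have h1 : (M.outcome v).price ≤
        τ + ((copyPayment M j v - τ * (M.outcome v).prob j) + otherMax j v) := by linarith
    calc ENNReal.ofReal (M.outcome v).price
        ≤ ENNReal.ofReal τ + (ENNReal.ofReal (copyPayment M j v - τ * (M.outcome v).prob j)
            + ENNReal.ofReal (otherMax j v)) :=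
          (ENNReal.ofReal_le_ofReal h1).trans <| ENNReal.ofReal_add_le.trans <| by
            gcongr; exact ENNReal.ofReal_add_le
      _ ≤ τ + (ENNReal.ofReal (copyPayment M j v - τ * (M.outcome v).prob j)
            + (τ + ((otherMax j v : ℝ≥0∞) - τ))) := by
          rw [ENNReal.ofReal_coe_nnreal, ENNReal.ofReal_coe_nnreal]
          gcongr
          exact le_add_tsub
      _ = _ := by ring

/-! ### Comparison of the revenues -/

/-- An integral over a product of probability measures is bounded by any uniform bound on the
integrals over a single coordinate. -/
lemma lintegral_pi_le_of_forall_lintegral_update_le (F : Fin m → Measure ℝ≥0)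
    [∀ j, IsProbabilityMeasure (F j)] (j : Fin m) {f : Valuation m → ℝ≥0∞} (hf : Measurable f)
    {B : ℝ≥0∞} (h : ∀ v, ∫⁻ t, f (Function.update v j t) ∂F j ≤ B) :
    ∫⁻ v, f v ∂Measure.pi F ≤ B := by
  have h1 : ∫⁻ v, f v ∂Measure.pi F ≤ ∫⁻ _, B ∂Measure.pi F := by
    refine lintegral_le_of_lmarginal_le {j} hf measurable_const ?_
    rw [lmarginal_singleton, lmarginal_singleton]
    intro v
    simpa using h v
  simpa using h1

/-- If no item pricing earns `τ` or more, then no randomized mechanism earns more than `4 * τ`. -/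
lemma lintegral_price_le (F : Fin m → Measure ℝ≥0) [∀ j, IsProbabilityMeasure (F j)] {τ : ℝ≥0}
    (hτ : ∀ p : Valuation m, ∫⁻ v, (itemPricingPrice p v : ℝ≥0∞) ∂Measure.pi F < τ)
    (M : RandomizedMechanism m) :
    ∫⁻ v, ENNReal.ofReal (M.outcome v).price ∂Measure.pi F ≤ 4 * τ := by
  set B : Fin m → ℝ≥0∞ := fun j => ⨆ p : ℝ≥0, ((p : ℝ≥0∞) - τ) * F j (Set.Ici p) with hB
  have hle : ∀ j (p : ℝ≥0), ((p : ℝ≥0∞) - τ) * F j (Set.Ici p) ≤ B j := fun j p =>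
    le_iSup (fun p : ℝ≥0 => ((p : ℝ≥0∞) - τ) * F j (Set.Ici p)) p
  have hBsum : ∑ j, B j ≤ τ := by
    have := sum_iSup_le_of_forall_sum_le (f := fun j (p : ℝ≥0) =>
      ((p : ℝ≥0∞) - τ) * F j (Set.Ici p)) Finset.univ (C := τ) 0
      fun p => by simpa using sum_excess_le F hτ p
    simpa using this
  have hms : ∀ j, MeasurableSet {v : Valuation m | otherMax j v ≤ v j} := fun j =>
    measurableSet_le (measurable_otherMax j) (measurable_pi_apply j)
  have hm1 : ∀ j, Measurable ({v : Valuation m | otherMax j v ≤ v j}.indicator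
      fun v => ENNReal.ofReal (copyPayment M j v - τ * (M.outcome v).prob j)) := fun j =>
    (((measurable_copyPayment M j).sub
      ((M.measurable_prob j).const_mul _)).ennreal_ofReal).indicator (hms j)
  have hm2 : ∀ j, Measurable ({v : Valuation m | otherMax j v ≤ v j}.indicator
      fun v => (otherMax j v : ℝ≥0∞) - τ) := fun j =>
    ((measurable_otherMax j).coe_nnreal_ennreal.sub_const _).indicator (hms j)
  have hcopy : ∀ j, ∫⁻ v, {v : Valuation m | otherMax j v ≤ v j}.indicator
      (fun v => ENNReal.ofReal (copyPayment M j v - τ * (M.outcome v).prob j)) v ∂Measure.pi F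
      ≤ B j := by
    intro j
    refine lintegral_pi_le_of_forall_lintegral_update_le F j (hm1 j) fun v => ?_
    have hone := lintegral_payment_le_of_postedPrice_le (hle j) (s := otherMax j v)
      (x := fun t => (M.outcome (Function.update v j t)).prob j)
      (pay := fun t => copyPayment M j (Function.update v j t))
      ((M.measurable_prob j).comp (measurable_update v))
      (fun t => (M.outcome _).prob_nonneg j) (fun t => M.prob_le_one _ j)
      (fun t w => by
        have := M.prob_mul_sub_le v j t w
        simp only [copyPayment, Function.update_self, otherMax_update, Function.update_idem]
        linarith)
      (by simp [copyPayment, otherMax_update])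
    rw [← lintegral_indicator measurableSet_Ici] at hone
    refine le_of_eq_of_le (lintegral_congr fun t => ?_) hone
    simp [Set.indicator, otherMax_update]
  have hsecond : ∀ j, ∫⁻ v, {v : Valuation m | otherMax j v ≤ v j}.indicator
      (fun v => (otherMax j v : ℝ≥0∞) - τ) v ∂Measure.pi F ≤ B j := by
    intro j
    refine lintegral_pi_le_of_forall_lintegral_update_le F j (hm2 j) fun v => ?_
    refine le_of_eq_of_le ?_ (hle j (otherMax j v))
    rw [← lintegral_indicator_const measurableSet_Ici]
    refine lintegral_congr fun t => ?_
    simp [Set.indicator, otherMax_update]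
  calc ∫⁻ v, ENNReal.ofReal (M.outcome v).price ∂Measure.pi F
      ≤ _ := lintegral_mono fun v => ofReal_price_le M τ v
    _ ≤ 2 * τ + ∑ j, (B j + B j) := by
        rw [lintegral_add_left measurable_const,
          lintegral_finsetSum _ fun j _ => (hm1 j).fun_add (hm2 j), lintegral_const, measure_univ,
          mul_one]
        gcongr with j
        rw [lintegral_add_left (hm1 j)]
        exact add_le_add (hcopy j) (hsecond j)
    _ ≤ 2 * τ + (τ + τ) := by
        rw [Finset.sum_add_distrib]
        gcongr
    _ = 4 * τ := by ring

end UnitDemand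

theorem mainTheorem1 {m : ℕ} (F : Fin m → Measure ℝ≥0) [∀ j, IsProbabilityMeasure (F j)] :
    UnitDemand.optRandomizedRevenue (Measure.pi F)
      ≤ 4 * UnitDemand.optDeterministicRevenue (Measure.pi F) := by
  open UnitDemand in
  set D := optDeterministicRevenue (Measure.pi F)
  have hle : ∀ p, ((∫⁻ v, (itemPricingPrice p v : ℝ≥0∞) ∂Measure.pi F : ℝ≥0∞) : EReal) ≤ D :=
    fun p => by
      rw [← expectedRevenue_itemPricing]
      exact le_iSup (fun M : DeterministicMechanism m => expectedRevenue (Measure.pi F) M.price)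
        (itemPricing p)
  have hD0 : 0 ≤ D := le_trans (EReal.coe_ennreal_nonneg _) (hle 0)
  obtain ⟨d, hd⟩ : ∃ d : ℝ≥0∞, (d : EReal) = D := ⟨D.toENNReal, EReal.coe_toENNReal hD0⟩
  rw [← hd]
  refine iSup_le fun M => ?_
  have hM : ∫⁻ v, ENNReal.ofReal (M.outcome v).price ∂Measure.pi F ≤ 4 * d := by
    by_contra! hlt
    -- A violation leaves room for a real `τ` above `d` that the mechanism still beats fourfold.
    rw [mul_comm, ← ENNReal.lt_div_iff_mul_lt (by simp) (by simp)] at hlt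
    obtain ⟨τ, hdτ, hτ⟩ := ENNReal.lt_iff_exists_nnreal_btwn.1 hlt
    rw [ENNReal.lt_div_iff_mul_lt (by simp) (by simp), mul_comm] at hτ
    refine absurd (lintegral_price_le F (fun p => lt_of_le_of_lt ?_ hdτ) M) (not_le.2 hτ)
    have := hle p
    rw [← hd] at this
    exact_mod_cast this
  calc expectedRevenue (Measure.pi F) (fun v => (M.outcome v).price)
      ≤ ((∫⁻ v, ENNReal.ofReal (M.outcome v).price ∂Measure.pi F : ℝ≥0∞) : EReal) :=
        EReal.sub_le_of_le_add' (le_add_of_nonneg_left (EReal.coe_ennreal_nonneg _))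
    _ ≤ ((4 * d : ℝ≥0∞) : EReal) := by exact_mod_cast hM
    _ = 4 * (d : EReal) := by rw [EReal.coe_ennreal_mul]; rfl
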